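/- Let $\eta(x)=-x\log x$ for $x>0$, $\eta(0)=0$. Let $\mathcal G_0$ be the set of concave functions $g\colon[0,1]\to\mathbb R$ with $g(0)=\lim_{x\to0^+}g(x)=0$, and let $\mathcal G_0^\infty$ be the set of $g\in\mathcal G_0$ with $\lim_{x\to0^+}g(x)/\eta(x)=\infty$. A process $(X,\Sigma,\mu,T,\mathcal P)$ consists of an automorphism $T$ (an invertible, bimeasurable, measure-preserving map) of a standard probability space $(X,\Sigma,\mu)$ and a finite measurable partition $\mathcal P$ of $X$. With $\mathcal P_n=\mathcal P\vee T^{-1}\mathcal P\vee\dots\vee T^{-n+1}\mathcal P$, its dynamical $g$-entropy is $$h(g,\mathcal P)=\limsup_{n\to\infty}\frac1n\sum_{A\in\mathcal P_n}g(\mu(A))\in[-\infty,\infty],$$ and $h(\eta,\mathcal P)$ is its dynamical Shannon entropy. **Theorem.** Let $g\in\mathcal G_0^\infty$ be differentiable on $(0,1)$ and suppose that $$\limsup_{x\to0^+}\frac{x\,g'(x)}{g(x)}<1 .$$ Then for every real $\gamma\ge 0$ there exists a process $(X,\Sigma,\mu,T,\mathcal P)$ with $$h(g,\mathcal P)=\gamma\qquad\text{and}\qquad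 h(\eta,\mathcal P)=0 .$$ Moreover, the process can be taken to be a subshift over two symbols: $X=\{0,1\}^{\mathbb Z}$ with its Borel $\sigma$-algebra, $\mu$ a shift-invariant Borel probability measure, $T$ the left shift, and $\mathcal P=\{\{x:x_0=0\},\{x:x_0=1\}\}$ the zero-coordinate partition. -/

import Mathlib

open Set Filter Topology MeasureTheory

/-- Concave functions `g : [0,1] → ℝ` with `g 0 = lim_{x → 0+} g x = 0`. Such a function is
represented by a function on `ℝ` of which only the values on `[0,1]` are constrained or used. -/
def G0 : Set (ℝ → ℝ) :=
  {g | ConcaveOn ℝ (Icc 0 1) g ∧ g 0 = 0 ∧ Tendsto g (𝓝[>] 0) (𝓝 0)}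

/-- Functions `g` of the class `G0` with `g x / η x → ∞` as `x → 0+`, where
`η x = - x log x` is the Shannon function `Real.negMulLog`. -/
def G0Infty : Set (ℝ → ℝ) :=
  {g | g ∈ G0 ∧ Tendsto (fun x => g x / Real.negMulLog x) (𝓝[>] 0) atTop}

/-- A measurable partition of `X` with cells indexed by `ι` (cells may be empty). -/
structure MeasurablePartition (X : Type) [MeasurableSpace X] (ι : Type) where
  cell : ι → Set X
  measurableSet_cell : ∀ i, MeasurableSet (cell i)
  disjoint_cell : ∀ i j, i ≠ j → Disjoint (cell i) (cell j)
  iUnion_cell : ⋃ i, cell i = univ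

namespace MeasurablePartition

variable {X : Type} [MeasurableSpace X] {ι : Type}

/-- The join `P ∨ T⁻¹ P ∨ ... ∨ T⁻ⁿ⁺¹ P`; its cells are the sets
`P (w 0) ∩ T⁻¹ P (w 1) ∩ ... ∩ T⁻ⁿ⁺¹ P (w (n-1))`. -/
def iteratedJoin (P : MeasurablePartition X ι) (T : X ≃ᵐ X) (n : ℕ) :
    MeasurablePartition X (Fin n → ι) where
  cell w := ⋂ j : Fin n, (T^[(j : ℕ)]) ⁻¹' P.cell (w j)
  measurableSet_cell w := MeasurableSet.iInter fun j =>
    (T.measurable.iterate (j : ℕ)) (P.measurableSet_cell (w j))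
  disjoint_cell v w hvw := by
    obtain ⟨j, hj⟩ := Function.ne_iff.mp hvw
    rw [Set.disjoint_left]
    intro x hv hw
    exact Set.disjoint_left.mp (P.disjoint_cell _ _ hj)
      (mem_iInter.mp hv j) (mem_iInter.mp hw j)
  iUnion_cell := by
    refine eq_univ_of_forall fun x => ?_
    have h : ∀ j : Fin n, ∃ i, (T^[(j : ℕ)]) x ∈ P.cell i := fun j =>
      mem_iUnion.mp (P.iUnion_cell ▸ mem_univ _)
    choose w hw using h
    exact mem_iUnion.mpr ⟨w, mem_iInter.mpr hw⟩

/-- The static `g`-entropy `∑ g (μ A)` over the cells `A`; an empty cell contributes `g 0`,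
which is `0` for `g` in `G0`. -/
noncomputable def staticEntropy [Fintype ι] (P : MeasurablePartition X ι) (μ : Measure X)
    (g : ℝ → ℝ) : ℝ :=
  ∑ i, g (μ.real (P.cell i))

end MeasurablePartition

/-- A process `(X, Σ, μ, T, P)`: an automorphism `T` of a standard probability space together
with a finite measurable partition. -/
structure PartitionedSystem where
  X : Type
  measurableSpace : MeasurableSpace X
  standardBorelSpace : StandardBorelSpace X
  μ : Measure X
  isProbabilityMeasure : IsProbabilityMeasure μ
  T : X ≃ᵐ X
  measurePreserving : MeasurePreserving T μ μ
  k : ℕ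
  P : MeasurablePartition X (Fin k)

/-- The dynamical `g`-entropy `h(g, P) = limsup (1/n) H(g, P_n)` of a process, as an extended
real number. -/
noncomputable def PartitionedSystem.gEntropy (S : PartitionedSystem) (g : ℝ → ℝ) : EReal :=
  letI := S.measurableSpace
  limsup (fun n : ℕ =>
    (((1 / (n : ℝ)) * (S.P.iteratedJoin S.T n).staticEntropy S.μ g : ℝ) : EReal)) atTop

/-- The dynamical Shannon entropy of a process. -/
noncomputable def PartitionedSystem.shannonEntropy (S : PartitionedSystem) : EReal :=
  S.gEntropy Real.negMulLog

/-- The left shift `(σ x) i = x (i + 1)` on `{0,1}^ℤ`. -/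
def binaryShift : (ℤ → Fin 2) ≃ᵐ (ℤ → Fin 2) where
  toFun x i := x (i + 1)
  invFun x i := x (i - 1)
  left_inv x := by funext i; simp
  right_inv x := by funext i; simp
  measurable_toFun := measurable_pi_lambda _ fun i => measurable_pi_apply (i + 1)
  measurable_invFun := measurable_pi_lambda _ fun i => measurable_pi_apply (i - 1)

/-- The zero-coordinate partition of `{0,1}^ℤ`. -/
def zeroCoordinatePartition : MeasurablePartition (ℤ → Fin 2) (Fin 2) where
  cell a := {x | x 0 = a}
  measurableSet_cell a :=
    (measurable_pi_apply (X := fun _ : ℤ => Fin 2) (0 : ℤ)) (measurableSet_singleton a)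
  disjoint_cell a b hab := by
    rw [Set.disjoint_left]
    intro x hx hy
    exact hab (hx.symm.trans hy)
  iUnion_cell := eq_univ_of_forall fun x => mem_iUnion.mpr ⟨x 0, rfl⟩

/-- The process given by a shift-invariant probability measure on `{0,1}^ℤ` (that is, by a
measure-preserving subshift over two symbols) and the zero-coordinate partition. -/
def binaryShiftSystem (μ : Measure (ℤ → Fin 2)) (hμ : IsProbabilityMeasure μ)
    (hinv : MeasurePreserving binaryShift μ μ) : PartitionedSystem where
  X := ℤ → Fin 2
  measurableSpace := inferInstance
  standardBorelSpace := inferInstance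
  μ := μ
  isProbabilityMeasure := hμ
  T := binaryShift
  measurePreserving := hinv
  k := 2
  P := zeroCoordinatePartition

/-! ### Concave functions vanishing at the origin -/

/-! The measure is a mixture: weight `p k` on the uniform measure over sequences of period `L k`,
and the remaining mass on the zero sequence. By concavity, component `k` alone has `g`-entropy at
most `2 ^ n * g (p k / 2 ^ n)` at times `n ≤ L k`; from `L k` on, the word determines the periodic
point and the entropy freezes at its value there. Since `g / η → ∞`, the ratio of `2 ^ n * g (t / 2
^ n)` to `n` reaches `γ` for every fixed `t > 0`, however small; tuning `t` by the intermediate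
value theorem makes its maximum over a range of `n` equal to `γ`, attained at `n = L k`
(`G0Infty.exists_weight_and_period`).

Periods grow and weights shrink so fast that at each time at most one component matters: earlier
ones are frozen, later ones have almost no mass. Subadditivity of `g` gives the upper bound
(`AdaptedWeights.sum_comp_tsum_le`), monotonicity of `g` near `0` the lower bound along `n = L k`
(`AdaptedWeights.le_sum_comp_tsum`). Finite `g`-entropy forces zero Shannon entropy because `η ≤ ε *
g + K * x` (`PartitionedSystem.shannonEntropy_eq_zero`). -/

theorem ConcaveOn.mul_le_of_map_zero {g : ℝ → ℝ} (hg : ConcaveOn ℝ (Icc 0 1) g) (h0 : g 0 = 0)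
    {t s : ℝ} (ht : t ∈ Icc (0 : ℝ) 1) (hs : s ∈ Icc (0 : ℝ) 1) : t * g s ≤ g (t * s) := by
  have := hg.2 hs (left_mem_Icc.mpr zero_le_one) ht.1 (sub_nonneg.mpr ht.2) (by ring)
  simpa [h0] using this

theorem ConcaveOn.map_sum_le_of_map_zero {g : ℝ → ℝ} (hg : ConcaveOn ℝ (Icc 0 1) g)
    (h0 : g 0 = 0) {ι : Type*} (s : Finset ι) (x : ι → ℝ) (hx : ∀ i ∈ s, 0 ≤ x i)
    (hsum : ∑ i ∈ s, x i ≤ 1) : g (∑ i ∈ s, x i) ≤ ∑ i ∈ s, g (x i) := by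
  rcases (Finset.sum_nonneg hx).eq_or_lt with h | h
  · rw [← h, h0]
    refine (Finset.sum_eq_zero fun i hi => ?_).ge
    rw [(Finset.sum_eq_zero_iff_of_nonneg hx).mp h.symm i hi, h0]
  · set S := ∑ i ∈ s, x i with hS
    calc g S = ∑ i ∈ s, x i / S * g S := by
          rw [← Finset.sum_mul, ← Finset.sum_div, ← hS, div_self h.ne', one_mul]
      _ ≤ ∑ i ∈ s, g (x i) := by
          refine Finset.sum_le_sum fun i hi => ?_
          have hle : x i ≤ S := Finset.single_le_sum hx hi
          have := hg.mul_le_of_map_zero h0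
            ⟨div_nonneg (hx i hi) h.le, (div_le_one h).mpr hle⟩ ⟨h.le, hsum⟩
          rwa [div_mul_cancel₀ _ h.ne'] at this

theorem ConcaveOn.sum_le_card_mul {g : ℝ → ℝ} (hg : ConcaveOn ℝ (Icc 0 1) g) {ι : Type*}
    [Fintype ι] [Nonempty ι] (x : ι → ℝ) (hx : ∀ i, x i ∈ Icc (0 : ℝ) 1) :
    ∑ i, g (x i) ≤ Fintype.card ι * g ((∑ i, x i) / Fintype.card ι) := by
  have hc : (0 : ℝ) < Fintype.card ι := by exact_mod_cast Fintype.card_pos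
  have := hg.le_map_sum (t := Finset.univ) (w := fun _ : ι => (Fintype.card ι : ℝ)⁻¹) (p := x)
    (fun _ _ => (inv_pos.mpr hc).le) (by simp [hc.ne']) (fun i _ => hx i)
  simp only [smul_eq_mul, ← Finset.mul_sum] at this
  rw [inv_mul_le_iff₀ hc] at this
  rwa [div_eq_inv_mul]

/-- The endpoint values bound `g` from below; then `g x + g (1 - x) ≤ 2 * g (1 / 2)` bounds it from
above. -/
theorem ConcaveOn.exists_abs_le_Icc {g : ℝ → ℝ} (hg : ConcaveOn ℝ (Icc 0 1) g) :
    ∃ M, 0 ≤ M ∧ ∀ x ∈ Icc (0 : ℝ) 1, |g x| ≤ M := by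
  have h0 : (0 : ℝ) ∈ Icc (0 : ℝ) 1 := by simp
  have h1 : (1 : ℝ) ∈ Icc (0 : ℝ) 1 := by simp
  have hlow : ∀ x ∈ Icc (0 : ℝ) 1, min (g 0) (g 1) ≤ g x := fun x hx =>
    hg.min_le_of_mem_Icc h0 h1 hx
  refine ⟨2 * |g (1 / 2)| + |min (g 0) (g 1)|, by positivity, fun x hx => ?_⟩
  have hx' : 1 - x ∈ Icc (0 : ℝ) 1 := ⟨by linarith [hx.2], by linarith [hx.1]⟩
  have hm := hg.2 hx hx' (show (0 : ℝ) ≤ 1 / 2 by norm_num) (show (0 : ℝ) ≤ 1 / 2 by norm_num)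
    (by norm_num)
  simp only [smul_eq_mul] at hm
  rw [show 1 / 2 * x + 1 / 2 * (1 - x) = (1 / 2 : ℝ) by ring] at hm
  have := hlow x hx
  have := hlow _ hx'
  have := neg_abs_le (min (g 0) (g 1))
  have := le_abs_self (g (1 / 2))
  have := abs_nonneg (g (1 / 2))
  rw [abs_le]
  constructor <;> linarith

theorem G0.continuousWithinAt_zero {g : ℝ → ℝ} (hg : g ∈ G0) :
    ContinuousWithinAt g (Ici 0) 0 := by
  rw [← continuousWithinAt_Ioi_iff_Ici, ContinuousWithinAt, hg.2.1]
  exact hg.2.2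

/-- The point `1` is left out because a concave function may jump down there. -/
theorem G0.continuousOn {g : ℝ → ℝ} (hg : g ∈ G0) : ContinuousOn g (Ico 0 1) := by
  intro x hx
  rcases hx.1.eq_or_lt with rfl | h
  · exact (G0.continuousWithinAt_zero hg).mono Ico_subset_Ici_self
  · have := hg.1.continuousOn_interior
    rw [interior_Icc] at this
    exact (this.continuousAt (Ioo_mem_nhds h hx.2)).continuousWithinAt

/-! ### Functions dominating the Shannon function near the origin -/

theorem G0Infty.exists_mul_negMulLog_le {g : ℝ → ℝ} (hg : g ∈ G0Infty) (K : ℝ) :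
    ∃ r ∈ Ioo (0 : ℝ) 1, ∀ x ∈ Ioo (0 : ℝ) r, K * Real.negMulLog x ≤ g x := by
  have h := hg.2.eventually_ge_atTop K
  obtain ⟨r, hr, hr'⟩ := mem_nhdsGT_iff_exists_Ioo_subset.mp h
  refine ⟨min r (1 / 2), ⟨lt_min hr (by norm_num), (min_le_right _ _).trans_lt (by norm_num)⟩,
    fun x hx => ?_⟩
  have hx1 : x < 1 := (hx.2.trans_le (min_le_right _ _)).trans (by norm_num)
  have hK : K ≤ g x / Real.negMulLog x := hr' ⟨hx.1, hx.2.trans_le (min_le_left _ _)⟩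
  have hpos : 0 < Real.negMulLog x := by
    rw [Real.negMulLog, neg_mul, ← mul_neg]
    exact mul_pos hx.1 (neg_pos.mpr (Real.log_neg hx.1 hx1))
  exact (le_div_iff₀ hpos).mp hK

/-- Some value `g (r / 2)` is positive, while `g` is below it near `0`. For small `x ≤ y`, concavity
gives `min (g x) (g (r / 2)) ≤ g y`, and the second alternative is excluded. -/
theorem G0Infty.exists_monotoneOn {g : ℝ → ℝ} (hg : g ∈ G0Infty) :
    ∃ δ, 0 < δ ∧ δ ≤ 1 / 2 ∧ MonotoneOn g (Icc 0 δ) := by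
  obtain ⟨⟨hconc, h0, hlim⟩, -⟩ := id hg
  obtain ⟨r, ⟨hr0, hr1⟩, hr⟩ := G0Infty.exists_mul_negMulLog_le hg 1
  have hgc : 0 < g (r / 2) := by
    refine lt_of_lt_of_le ?_ (hr (r / 2) ⟨by linarith, by linarith⟩)
    rw [one_mul, Real.negMulLog, neg_mul, ← mul_neg]
    exact mul_pos (by linarith) (neg_pos.mpr (Real.log_neg (by linarith) (by linarith)))
  obtain ⟨d, hd, hd'⟩ := mem_nhdsGT_iff_exists_Ioo_subset.mp (hlim.eventually_lt_const hgc)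
  have hd0 : 0 < d := hd
  refine ⟨min (d / 2) (r / 4), lt_min (by linarith) (by linarith),
    (min_le_right _ _).trans (by linarith), fun x hx y hy hxy => ?_⟩
  have hyd := hy.2.trans (min_le_left _ _)
  have hyr := hy.2.trans (min_le_right _ _)
  rcases hy.1.eq_or_lt with h | h
  · rw [le_antisymm (hxy.trans h.symm.le) hx.1, ← h]
  · have hlt : g y < g (r / 2) := hd' ⟨h, by linarith⟩
    have hmin := hconc.min_le_of_mem_Icc (x := x) (y := r / 2) (z := y)
      ⟨hx.1, by linarith⟩ ⟨by linarith, by linarith⟩ ⟨hxy, by linarith⟩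
    rcases min_le_iff.mp hmin with h | h
    · exact h
    · exact absurd h hlt.not_ge

theorem G0Infty.exists_negMulLog_le {g : ℝ → ℝ} (hg : g ∈ G0Infty) {ε : ℝ} (hε : 0 < ε) :
    ∃ K, 0 ≤ K ∧ ∀ x ∈ Icc (0 : ℝ) 1, Real.negMulLog x ≤ ε * g x + K * x := by
  obtain ⟨M, hM0, hM⟩ := hg.1.1.exists_abs_le_Icc
  obtain ⟨r, ⟨hr0, hr1⟩, hr⟩ := G0Infty.exists_mul_negMulLog_le hg ε⁻¹
  refine ⟨(1 + ε * M) / r, by positivity, fun x hx => ?_⟩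
  rcases hx.1.eq_or_lt with rfl | h
  · simp [hg.1.2.1]
  rcases lt_or_ge x r with hxr | hxr
  · have := (inv_mul_le_iff₀ hε).mp (hr x ⟨h, hxr⟩)
    have : 0 ≤ (1 + ε * M) / r * x := by positivity
    linarith
  · have h1 : 1 + ε * M ≤ (1 + ε * M) / r * x := by
      rw [div_mul_eq_mul_div, le_div_iff₀ hr0]
      gcongr
    have h2 : Real.negMulLog x ≤ 1 := by
      have := Real.negMulLog_le_one_sub_self hx.1
      linarith [hx.1]
    have h3 := mul_le_mul_of_nonneg_left (neg_le_of_abs_le (hM x hx)) hε.le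
    linarith

theorem G0Infty.exists_le_two_pow_mul {g : ℝ → ℝ} (hg : g ∈ G0Infty) (γ : ℝ) {q : ℝ}
    (hq : 0 < q) (hq1 : q ≤ 1) (hγ : 0 ≤ γ) :
    ∃ n : ℕ, 1 ≤ n ∧ γ * n ≤ 2 ^ n * g (q / 2 ^ n) := by
  have hlog : 0 < Real.log 2 := Real.log_pos (by norm_num)
  -- `2 ^ n * η (q / 2 ^ n) = q * (n * log 2 - log q) ≥ q * n * log 2`, so this factor yields
  -- exactly `γ * n`.
  obtain ⟨r, ⟨hr0, -⟩, hr⟩ := G0Infty.exists_mul_negMulLog_le hg (γ / (q * Real.log 2))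
  obtain ⟨n, hn⟩ := pow_unbounded_of_one_lt (q / r) (one_lt_two (α := ℝ))
  have hn' : q / r < 2 ^ (n + 1) := hn.trans_le (pow_le_pow_right₀ one_le_two n.le_succ)
  refine ⟨n + 1, by omega, ?_⟩
  have h2 : (0 : ℝ) < 2 ^ (n + 1) := by positivity
  have hx := hr (q / 2 ^ (n + 1)) ⟨by positivity, by
    rw [div_lt_iff₀ h2]; rw [div_lt_iff₀ hr0] at hn'; linarith⟩
  rw [Real.negMulLog, Real.log_div hq.ne' h2.ne', Real.log_pow] at hx
  have hlq : Real.log q ≤ 0 := Real.log_nonpos hq.le hq1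
  have hle : γ * ((n + 1 : ℕ) : ℝ) ≤ 2 ^ (n + 1) * (γ / (q * Real.log 2) *
      (-(q / 2 ^ (n + 1)) * (Real.log q - ((n + 1 : ℕ) : ℝ) * Real.log 2))) := by
    have : 2 ^ (n + 1) * (γ / (q * Real.log 2) *
      (-(q / 2 ^ (n + 1)) * (Real.log q - ((n + 1 : ℕ) : ℝ) * Real.log 2))) =
      γ * ((n + 1 : ℕ) : ℝ) + γ * (-Real.log q) / Real.log 2 := by
      field_simp
      ring
    rw [this]
    have : 0 ≤ γ * (-Real.log q) / Real.log 2 :=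
      div_nonneg (mul_nonneg hγ (by linarith)) hlog.le
    linarith
  exact hle.trans (mul_le_mul_of_nonneg_left hx h2.le)

theorem G0Infty.exists_weight_and_period {g : ℝ → ℝ} (hg : g ∈ G0Infty) {δ : ℝ}
    (hδ : δ ≤ 1 / 2) (hmono : MonotoneOn g (Icc 0 δ)) {γ : ℝ} (hγ : 0 < γ) (N : ℕ) (p₀ : ℝ)
    (hp₀ : 0 < p₀ ∧ p₀ ≤ δ) :
    ∃ (p : ℝ) (L : ℕ), 0 < p ∧ 2 * p ≤ p₀ ∧ N < L ∧ 2 ^ N * g (2 * p) ≤ γ / 2 ∧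
      (∀ n : ℕ, 1 ≤ n → n ≤ L → 2 ^ n * g (p / 2 ^ n) ≤ γ * n) ∧
      2 ^ L * g (p / 2 ^ L) = γ * L := by
  -- An upper limit `q` for the weight, small enough that rate `γ` cannot be reached at any time up
  -- to `N`.
  obtain ⟨q, hq0, hqp, hq⟩ : ∃ q, 0 < q ∧ 2 * q ≤ p₀ ∧ 2 ^ N * g (2 * q) ≤ γ / 2 := by
    have hpos : 0 < γ / 2 / 2 ^ N := by positivity
    obtain ⟨d, hd, hd'⟩ := mem_nhdsGT_iff_exists_Ioo_subset.mp
      (hg.1.2.2.eventually_lt_const hpos)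
    have hd0 : 0 < d := hd
    refine ⟨min (d / 4) (p₀ / 2), lt_min (by linarith) (by linarith),
      by linarith [min_le_right (d / 4) (p₀ / 2)], ?_⟩
    have hm : 0 < min (d / 4) (p₀ / 2) := lt_min (by linarith) (by linarith)
    have : g (2 * min (d / 4) (p₀ / 2)) < γ / 2 / 2 ^ N :=
      hd' ⟨by linarith, by linarith [min_le_left (d / 4) (p₀ / 2)]⟩
    rw [lt_div_iff₀ (by positivity)] at this
    linarith
  obtain ⟨n₀, hn₀, hge⟩ := G0Infty.exists_le_two_pow_mul hg γ hq0 (by linarith) hγ.le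
  have hne : (Finset.Icc 1 n₀).Nonempty := ⟨n₀, by simp [hn₀]⟩
  -- A maximum over finitely many times is continuous in the weight; it vanishes at `0` and is at
  -- least `γ` at `q`. At a weight where it equals `γ`, the maximizing time is the period.
  let F : ℝ → ℝ := fun t => (Finset.Icc 1 n₀).sup' hne fun n => 2 ^ n * g (t / 2 ^ n) / n
  have hF : ContinuousOn F (Icc 0 q) := by
    refine ContinuousOn.finset_sup'_apply hne fun n _ => ?_
    refine ContinuousOn.div_const (continuousOn_const.mul ?_) _
    refine (G0.continuousOn hg.1).comp (by fun_prop) fun t ht => ?_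
    have h2 : (1 : ℝ) ≤ 2 ^ n := one_le_pow₀ one_le_two
    refine ⟨div_nonneg ht.1 (by positivity), (div_le_self ht.1 h2).trans_lt ?_⟩
    linarith [ht.2]
  have hF0 : F 0 = 0 := by
    simp [F, hg.1.2.1]
  have hFq : γ ≤ F q := by
    refine le_trans ?_ (Finset.le_sup' (fun n : ℕ => 2 ^ n * g (q / 2 ^ n) / n)
      (show n₀ ∈ Finset.Icc 1 n₀ by simp [hn₀]))
    rwa [le_div_iff₀ (by exact_mod_cast hn₀)]
  obtain ⟨p, ⟨hp0, hpq⟩, hFp⟩ := intermediate_value_Icc hq0.le hF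
    (show γ ∈ Icc (F 0) (F q) from ⟨hF0.le.trans hγ.le, hFq⟩)
  have hp : 0 < p := by
    refine hp0.lt_of_ne fun h => ?_
    rw [← h, hF0] at hFp
    exact hγ.ne hFp
  obtain ⟨L, hL, hFL⟩ := Finset.exists_mem_eq_sup' hne fun n : ℕ => 2 ^ n * g (p / 2 ^ n) / n
  rw [Finset.mem_Icc] at hL
  have hLpos : (0 : ℝ) < L := by exact_mod_cast hL.1
  have hLeq : 2 ^ L * g (p / 2 ^ L) = γ * L := by
    have : γ = 2 ^ L * g (p / 2 ^ L) / L := hFp.symm.trans hFL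
    rw [this, div_mul_cancel₀ _ hLpos.ne']
  have hNp : 2 ^ N * g (2 * p) ≤ γ / 2 := by
    refine le_trans (mul_le_mul_of_nonneg_left ?_ (by positivity)) hq
    exact hmono ⟨by linarith, by linarith⟩ ⟨by linarith, by linarith⟩ (by linarith)
  refine ⟨p, L, hp, by linarith, ?_, hNp, fun n hn hnL => ?_, hLeq⟩
  -- If `L ≤ N`, then `γ ≤ γ * L = 2 ^ L * g (p / 2 ^ L) ≤ 2 ^ N * g (2 * p) ≤ γ / 2`.
  · by_contra! hLN
    have h2 : (1 : ℝ) ≤ 2 ^ L := one_le_pow₀ one_le_two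
    have hple : p / 2 ^ L ≤ p := div_le_self hp.le h2
    have h3 : g (p / 2 ^ L) ≤ g (2 * p) :=
      hmono ⟨by positivity, by linarith⟩ ⟨by linarith, by linarith⟩ (by linarith)
    have h4 : 0 ≤ g (2 * p) := by
      rw [← hg.1.2.1]
      exact hmono ⟨le_rfl, by linarith⟩ ⟨by linarith, by linarith⟩ (by linarith)
    have h5 : 2 ^ L * g (p / 2 ^ L) ≤ 2 ^ N * g (2 * p) :=
      (mul_le_mul_of_nonneg_left h3 (by positivity)).trans
        (mul_le_mul_of_nonneg_right (pow_le_pow_right₀ one_le_two hLN) h4)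
    have h6 : γ * 1 ≤ γ * L := mul_le_mul_of_nonneg_left (by exact_mod_cast hL.1) hγ.le
    linarith
  · have := Finset.le_sup' (fun n : ℕ => 2 ^ n * g (p / 2 ^ n) / n)
      (show n ∈ Finset.Icc 1 n₀ by simp; omega)
    rw [← div_le_iff₀ (by exact_mod_cast hn)]
    exact this.trans hFp.le

/-! ### Mixtures of uniform measures on periodic points -/

theorem mem_iteratedJoin_cell {n : ℕ} {w : Fin n → Fin 2} {x : ℤ → Fin 2} :
    x ∈ (zeroCoordinatePartition.iteratedJoin binaryShift n).cell w ↔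
      ∀ j : Fin n, x (j : ℕ) = w j := by
  have h : ∀ (m : ℕ) (i : ℤ), (binaryShift^[m]) x i = x (i + m) := by
    intro m
    induction m with
    | zero => simp
    | succ m ih =>
      intro i
      rw [Function.iterate_succ_apply']
      change (binaryShift^[m]) x (i + 1) = _
      rw [ih]
      push_cast
      ring_nf
  simp only [MeasurablePartition.iteratedJoin, zeroCoordinatePartition, mem_iInter, mem_preimage,
    mem_ofPred_eq]
  exact forall_congr' fun j => by rw [h, zero_add]

/-- The periodic sequence with the given values on `ZMod L`. -/
def periodicPoint {L : ℕ} (b : ZMod L → Fin 2) : ℤ → Fin 2 := fun i => b i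

/-- The first `n` symbols of a periodic sequence. -/
def periodicWord {L : ℕ} (n : ℕ) (b : ZMod L → Fin 2) : Fin n → Fin 2 :=
  fun j => b ((j : ℕ) : ZMod L)

/-- The frequency of the word `w` among the sequences of period `L`. -/
noncomputable def wordFreq (L : ℕ) [NeZero L] {n : ℕ} (w : Fin n → Fin 2) : ℝ :=
  (Finset.univ.filter fun b : ZMod L → Fin 2 => periodicWord n b = w).card / 2 ^ L

/-- The uniform probability measure on the sequences of period `L`. -/
noncomputable def periodicMeasure (L : ℕ) [NeZero L] : Measure (ℤ → Fin 2) :=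
  ∑ b : ZMod L → Fin 2, ENNReal.ofReal (1 / 2 ^ L) • Measure.dirac (periodicPoint b)

section

variable (L : ℕ) [NeZero L]

theorem card_zmod_fun : Fintype.card (ZMod L → Fin 2) = 2 ^ L := by
  simp [ZMod.card]

theorem wordFreq_nonneg {n : ℕ} (w : Fin n → Fin 2) : 0 ≤ wordFreq L w := by
  unfold wordFreq; positivity

theorem sum_wordFreq (n : ℕ) : ∑ w : Fin n → Fin 2, wordFreq L w = 1 := by
  unfold wordFreq
  rw [← Finset.sum_div, ← Nat.cast_sum,
    ← Finset.card_eq_sum_card_fiberwise (fun _ _ => Finset.mem_coe.mpr (Finset.mem_univ _)),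
    Finset.card_univ, card_zmod_fun]
  simp

theorem wordFreq_le_one {n : ℕ} (w : Fin n → Fin 2) : wordFreq L w ≤ 1 := by
  rw [← sum_wordFreq L n]
  exact Finset.single_le_sum (fun w _ => wordFreq_nonneg L w) (Finset.mem_univ w)

theorem periodicWord_injective {n : ℕ} (h : L ≤ n) :
    Function.Injective (periodicWord (L := L) n) := by
  intro b c hbc
  funext i
  have := congrFun hbc ⟨i.val, (ZMod.val_lt i).trans_le h⟩
  simpa [periodicWord] using this

/-- A word of length at least `L` determines its periodic sequence, so `2 ^ L` words have frequency
`1 / 2 ^ L` and all others have frequency `0`. The entropy no longer depends on `n`. -/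
theorem sum_comp_wordFreq {g : ℝ → ℝ} (h0 : g 0 = 0) (p : ℝ) {n : ℕ} (h : L ≤ n) :
    ∑ w : Fin n → Fin 2, g (p * wordFreq L w) = 2 ^ L * g (p / 2 ^ L) := by
  have hinj := periodicWord_injective L h
  have hout : ∀ w ∈ (Finset.univ : Finset (Fin n → Fin 2)),
      w ∉ Finset.univ.image (periodicWord (L := L) n) → g (p * wordFreq L w) = 0 := by
    intro w _ hw
    have : Finset.univ.filter (fun b : ZMod L → Fin 2 => periodicWord n b = w) = ∅ := by
      refine Finset.filter_eq_empty_iff.mpr fun b _ hb => hw ?_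
      exact Finset.mem_image.mpr ⟨b, Finset.mem_univ _, hb⟩
    simp [wordFreq, this, h0]
  rw [← Finset.sum_subset (Finset.subset_univ _) hout, Finset.sum_image hinj.injOn]
  have hone : ∀ b : ZMod L → Fin 2, wordFreq L (periodicWord n b) = 1 / 2 ^ L := by
    intro b
    have : Finset.univ.filter (fun c : ZMod L → Fin 2 => periodicWord n c = periodicWord n b)
        = {b} := by
      ext c
      simp [hinj.eq_iff]
    simp [wordFreq, this]
  simp [hone, div_eq_mul_inv]

theorem periodicMeasure_cell {n : ℕ} (w : Fin n → Fin 2) :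
    periodicMeasure L ((zeroCoordinatePartition.iteratedJoin binaryShift n).cell w) =
      ENNReal.ofReal (wordFreq L w) := by
  classical
  have hmeas := (zeroCoordinatePartition.iteratedJoin binaryShift n).measurableSet_cell w
  have hmem : ∀ b : ZMod L → Fin 2,
      periodicPoint b ∈ (zeroCoordinatePartition.iteratedJoin binaryShift n).cell w ↔
        periodicWord n b = w := by
    intro b
    rw [mem_iteratedJoin_cell, funext_iff]
    simp [periodicPoint, periodicWord]
  simp only [periodicMeasure, Measure.coe_finsetSum, Finset.sum_apply, Measure.smul_apply,
    Measure.dirac_apply' _ hmeas, indicator_apply, hmem, Pi.one_apply, smul_eq_mul, mul_ite,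
    mul_one, mul_zero]
  rw [← Finset.sum_filter, Finset.sum_const, wordFreq, div_eq_mul_one_div (Nat.cast _),
    ENNReal.ofReal_mul (Nat.cast_nonneg _), ENNReal.ofReal_natCast, nsmul_eq_mul]

instance isProbabilityMeasure_periodicMeasure : IsProbabilityMeasure (periodicMeasure L) := by
  constructor
  simp only [periodicMeasure, Measure.coe_finsetSum, Finset.sum_apply, Measure.smul_apply,
    measure_univ, smul_eq_mul, mul_one, Finset.sum_const, Finset.card_univ, card_zmod_fun]
  rw [nsmul_eq_mul, ← ENNReal.ofReal_natCast, ← ENNReal.ofReal_mul (by positivity)]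
  simp

/-- The shift translates the index group `ZMod L`, hence permutes the equally weighted atoms. -/
theorem map_binaryShift_periodicMeasure :
    (periodicMeasure L).map binaryShift = periodicMeasure L := by
  have hpt : ∀ b : ZMod L → Fin 2, binaryShift (periodicPoint b) =
      periodicPoint ((Equiv.addRight (1 : ZMod L)).symm.arrowCongr (Equiv.refl (Fin 2)) b) := by
    intro b
    funext i
    simp [binaryShift, periodicPoint, Equiv.arrowCongr]
  unfold periodicMeasure
  rw [← Measure.mapₗ_apply_of_measurable binaryShift.measurable, map_sum]
  simp_rw [LinearMap.map_smul, Measure.mapₗ_apply_of_measurable binaryShift.measurable,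
    Measure.map_dirac' binaryShift.measurable, hpt]
  exact Equiv.sum_comp _
    (fun b : ZMod L → Fin 2 => ENNReal.ofReal (1 / 2 ^ L) • Measure.dirac (periodicPoint b))

end

/-- The mixture of the measures `periodicMeasure (L k)` with weights `p k`, the remaining mass
being placed on the zero sequence. -/
noncomputable def periodicMixture (p : ℕ → ℝ) (L : ℕ → ℕ) [∀ k, NeZero (L k)] :
    Measure (ℤ → Fin 2) :=
  ENNReal.ofReal (1 - ∑' k, p k) • Measure.dirac 0 +
    Measure.sum fun k => ENNReal.ofReal (p k) • periodicMeasure (L k)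

section

variable {p : ℕ → ℝ} (L : ℕ → ℕ) [∀ k, NeZero (L k)]

theorem isProbabilityMeasure_periodicMixture (hp : ∀ k, 0 ≤ p k) (hs : Summable p)
    (h1 : ∑' k, p k ≤ 1) : IsProbabilityMeasure (periodicMixture p L) := by
  constructor
  simp only [periodicMixture, Measure.add_apply, Measure.smul_apply, measure_univ, smul_eq_mul,
    mul_one, Measure.sum_apply _ MeasurableSet.univ]
  rw [← ENNReal.ofReal_tsum_of_nonneg hp hs,
    ← ENNReal.ofReal_add (sub_nonneg.mpr h1) (tsum_nonneg hp)]
  simp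

theorem measurePreserving_periodicMixture (p : ℕ → ℝ) :
    MeasurePreserving binaryShift (periodicMixture p L) (periodicMixture p L) := by
  refine ⟨binaryShift.measurable, ?_⟩
  unfold periodicMixture
  rw [Measure.map_add _ _ binaryShift.measurable, Measure.map_smul,
    Measure.map_dirac' binaryShift.measurable, Measure.map_sum binaryShift.measurable.aemeasurable]
  simp only [Measure.map_smul, map_binaryShift_periodicMeasure]
  rfl

theorem periodicMixture_real_cell (hp : ∀ k, 0 ≤ p k) (hs : Summable p) (h1 : ∑' k, p k ≤ 1)
    {n : ℕ} (w : Fin n → Fin 2) :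
    (periodicMixture p L).real ((zeroCoordinatePartition.iteratedJoin binaryShift n).cell w) =
      (if w = 0 then 1 - ∑' k, p k else 0) + ∑' k, p k * wordFreq (L k) w := by
  have hmeas := (zeroCoordinatePartition.iteratedJoin binaryShift n).measurableSet_cell w
  have hnn : ∀ k, 0 ≤ p k * wordFreq (L k) w := fun k => mul_nonneg (hp k) (wordFreq_nonneg _ _)
  have hs' : Summable fun k => p k * wordFreq (L k) w :=
    hs.of_nonneg_of_le hnn fun k => mul_le_of_le_one_right (hp k) (wordFreq_le_one _ _)
  have hmem : (0 : ℤ → Fin 2) ∈ (zeroCoordinatePartition.iteratedJoin binaryShift n).cell w ↔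
      w = 0 := by
    rw [mem_iteratedJoin_cell, funext_iff]
    simp [eq_comm]
  classical
  rw [Measure.real, periodicMixture, Measure.add_apply, Measure.sum_apply _ hmeas]
  simp only [Measure.smul_apply, Measure.dirac_apply' _ hmeas, indicator_apply, hmem,
    Pi.one_apply, smul_eq_mul, mul_ite, mul_one, mul_zero, periodicMeasure_cell,
    ← ENNReal.ofReal_mul (hp _)]
  rw [← ENNReal.ofReal_tsum_of_nonneg hnn hs', ENNReal.toReal_add (by split_ifs <;> simp) (by simp),
    ENNReal.toReal_ofReal (tsum_nonneg hnn)]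
  congr 1
  split_ifs
  · exact ENNReal.toReal_ofReal (sub_nonneg.mpr h1)
  · rfl

end

/-! ### Processes of finite `g`-entropy have zero Shannon entropy -/

theorem limsup_coe_ereal_eq {u : ℕ → ℝ} {a : ℝ} (hle : ∀ ε > 0, ∀ᶠ n in atTop, u n ≤ a + ε)
    (hge : ∀ ε > 0, ∃ᶠ n in atTop, a - ε ≤ u n) :
    limsup (fun n => (u n : EReal)) atTop = a := by
  apply le_antisymm
  · refine EReal.le_of_forall_lt_iff_le.mp fun z hz => ?_
    have hz' : a < z := by exact_mod_cast hz
    refine limsup_le_of_le (by isBoundedDefault) ?_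
    filter_upwards [hle (z - a) (sub_pos.mpr hz')] with n hn
    exact_mod_cast hn.trans_eq (by ring)
  · refine EReal.ge_of_forall_gt_iff_ge.mp fun z hz => ?_
    have hz' : z < a := by exact_mod_cast hz
    refine le_limsup_of_frequently_le ?_ (by isBoundedDefault)
    refine (hge (a - z) (sub_pos.mpr hz')).mono fun n hn => ?_
    exact_mod_cast (show z = a - (a - z) by ring).trans_le hn

namespace MeasurablePartition

variable {X : Type} [MeasurableSpace X] {ι : Type} [Fintype ι]

theorem sum_measureReal_cell (P : MeasurablePartition X ι) (μ : Measure X)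
    [IsProbabilityMeasure μ] : ∑ i, μ.real (P.cell i) = 1 := by
  have h := measureReal_biUnion_finset (μ := μ) (s := Finset.univ) (f := P.cell)
    (fun i _ j _ hij => P.disjoint_cell i j hij) (fun i _ => P.measurableSet_cell i)
  rw [← h]
  simp [P.iUnion_cell]

theorem staticEntropy_le_mul_add (P : MeasurablePartition X ι) (μ : Measure X)
    [IsProbabilityMeasure μ] {f g : ℝ → ℝ} {a b : ℝ}
    (h : ∀ x ∈ Icc (0 : ℝ) 1, f x ≤ a * g x + b * x) :
    P.staticEntropy μ f ≤ a * P.staticEntropy μ g + b := by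
  calc P.staticEntropy μ f
      ≤ ∑ i, (a * g (μ.real (P.cell i)) + b * μ.real (P.cell i)) :=
        Finset.sum_le_sum fun i _ => h _ ⟨measureReal_nonneg, measureReal_le_one⟩
    _ = a * P.staticEntropy μ g + b := by
        rw [Finset.sum_add_distrib, ← Finset.mul_sum, ← Finset.mul_sum, P.sum_measureReal_cell,
          mul_one, staticEntropy]

theorem staticEntropy_negMulLog_nonneg (P : MeasurablePartition X ι) (μ : Measure X)
    [IsProbabilityMeasure μ] : 0 ≤ P.staticEntropy μ Real.negMulLog :=
  Finset.sum_nonneg fun _ _ => Real.negMulLog_nonneg measureReal_nonneg measureReal_le_one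

end MeasurablePartition

theorem PartitionedSystem.shannonEntropy_eq_zero (S : PartitionedSystem) {g : ℝ → ℝ}
    (hg : g ∈ G0Infty) {γ : ℝ} (hγ : 0 ≤ γ) (h : S.gEntropy g = γ) : S.shannonEntropy = 0 := by
  let _ := S.measurableSpace
  have := S.isProbabilityMeasure
  refine limsup_coe_ereal_eq (a := 0) (fun ε hε => ?_) fun ε hε => ?_
  · have hlt : S.gEntropy g < ((γ + 1 : ℝ) : EReal) := by
      rw [h]
      exact_mod_cast lt_add_one γ
    have hev := eventually_lt_of_limsup_lt hlt (by isBoundedDefault)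
    have hγ1 : 0 < 2 * (γ + 1) := by linarith
    -- With factor `ε / (2 * (γ + 1))`, the `g`-term contributes at most `ε / 2`; the linear term
    -- contributes `K / n` because the cell masses sum to `1`.
    obtain ⟨K, -, hK⟩ := G0Infty.exists_negMulLog_le hg (div_pos hε hγ1)
    filter_upwards [hev, (tendsto_const_div_atTop_nhds_zero_nat K).eventually_le_const
      (half_pos hε)] with n hn hKn
    have hn' : 1 / (n : ℝ) * (S.P.iteratedJoin S.T n).staticEntropy S.μ g < γ + 1 := by
      exact_mod_cast hn
    have h1 := (S.P.iteratedJoin S.T n).staticEntropy_le_mul_add S.μ hK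
    have h2 := mul_le_mul_of_nonneg_left h1 (show (0 : ℝ) ≤ 1 / n by positivity)
    have h3 := mul_le_mul_of_nonneg_left hn'.le (div_pos hε hγ1).le
    have h4 : ε / (2 * (γ + 1)) * (γ + 1) = ε / 2 := by
      have : γ + 1 ≠ 0 := by linarith
      field_simp
    calc _ ≤ _ := h2
      _ = ε / (2 * (γ + 1)) * (1 / n * (S.P.iteratedJoin S.T n).staticEntropy S.μ g) + K / n := by
        ring
      _ ≤ 0 + ε := by linarith
  · refine Eventually.frequently (Eventually.of_forall fun n => ?_)
    have := (S.P.iteratedJoin S.T n).staticEntropy_negMulLog_nonneg S.μ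
    have : 0 ≤ 1 / (n : ℝ) * (S.P.iteratedJoin S.T n).staticEntropy S.μ Real.negMulLog := by
      positivity
    linarith

/-! ### The weights and the periods -/

/-- Weights and periods for which the component of period `L k` has its largest `g`-entropy rate,
namely `γ`, at time `L k`, while its earlier and the later components are negligible at that
time. -/
structure AdaptedWeights (g : ℝ → ℝ) (δ γ : ℝ) (p : ℕ → ℝ) (L : ℕ → ℕ) : Prop where
  pos : ∀ k, 0 < p k
  two_mul_zero_le : 2 * p 0 ≤ δ
  two_mul_succ_le : ∀ k, 2 * p (k + 1) ≤ p k
  lt_period : ∀ k, k * (1 + ∑ j ∈ Finset.range k, L j) < L k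
  -- Components from `k` on have total mass at most `2 * p k`; up to the time in the exponent, even
  -- giving that mass to every cell costs at most `γ / 2`.
  tail_le : ∀ k, 2 ^ (k * (1 + ∑ j ∈ Finset.range k, L j)) * g (2 * p k) ≤ γ / 2
  le_mul : ∀ k n, 1 ≤ n → n ≤ L k → 2 ^ n * g (p k / 2 ^ n) ≤ γ * n
  eq_mul : ∀ k, 2 ^ L k * g (p k / 2 ^ L k) = γ * L k

theorem exists_adaptedWeights {g : ℝ → ℝ} (hg : g ∈ G0Infty) {δ : ℝ} (hδ0 : 0 < δ)
    (hδ : δ ≤ 1 / 2) (hmono : MonotoneOn g (Icc 0 δ)) {γ : ℝ} (hγ : 0 < γ) :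
    ∃ p L, AdaptedWeights g δ γ p L := by
  choose! pf Lf hpos hle hlt htail hmul heq using
    G0Infty.exists_weight_and_period hg hδ hmono hγ
  -- The state holds the preceding weight (initially `δ`) and the sum of the periods chosen so far,
  -- so the `k`-th weight is read from state `k + 1`.
  let s : ℕ → ℝ × ℕ := fun k => Nat.rec (δ, 0)
    (fun k s => (pf (k * (1 + s.2)) s.1, s.2 + Lf (k * (1 + s.2)) s.1)) k
  have hs : ∀ k, 0 < (s k).1 ∧ (s k).1 ≤ δ := by
    intro k
    induction k with
    | zero => exact ⟨hδ0, le_rfl⟩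
    | succ k ih =>
      have h1 := hpos (k * (1 + (s k).2)) _ ih
      have h2 := hle (k * (1 + (s k).2)) _ ih
      exact ⟨h1, by change pf (k * (1 + (s k).2)) (s k).1 ≤ δ; linarith [ih.2]⟩
  let L : ℕ → ℕ := fun k => Lf (k * (1 + (s k).2)) (s k).1
  have hsum : ∀ k, ∑ j ∈ Finset.range k, L j = (s k).2 := by
    intro k
    induction k with
    | zero => rfl
    | succ k ih => rw [Finset.sum_range_succ, ih]
  refine ⟨fun k => (s (k + 1)).1, L, ⟨fun k => (hs (k + 1)).1, ?_, fun k => ?_, fun k => ?_, fun k => ?_,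
    fun k => ?_, fun k => ?_⟩⟩
  · exact hle _ _ (hs 0)
  · exact hle _ _ (hs (k + 1))
  · rw [hsum]; exact hlt _ _ (hs k)
  · rw [hsum]; exact htail _ _ (hs k)
  · exact hmul _ _ (hs k)
  · exact heq _ _ (hs k)

/-- These thresholds cut time into blocks; in block `k` the sum of the earlier periods is at most `n
/ k`. The summand `1` makes them increase strictly whatever `L` is. -/
theorem strictMono_mul_one_add_sum (L : ℕ → ℕ) :
    StrictMono fun k => k * (1 + ∑ j ∈ Finset.range k, L j) := by
  refine strictMono_nat_of_lt_succ fun k => ?_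
  rw [Finset.sum_range_succ]
  nlinarith [Nat.zero_le (k * L k), Nat.zero_le (∑ j ∈ Finset.range k, L j)]

/-! ### Entropy of the mixture for adapted weights -/

namespace AdaptedWeights

variable {g : ℝ → ℝ} {δ γ : ℝ} {p : ℕ → ℝ} {L : ℕ → ℕ}

theorem add_le (h : AdaptedWeights g δ γ p L) (k m : ℕ) : p (m + k) ≤ p k * (1 / 2) ^ m := by
  induction m with
  | zero => simp
  | succ m ih =>
    have := h.two_mul_succ_le (m + k)
    rw [show m + 1 + k = m + k + 1 by ring, pow_succ]
    linarith

theorem summable_add (h : AdaptedWeights g δ γ p L) (k : ℕ) : Summable fun m => p (m + k) :=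
  (summable_geometric_two.mul_left (p k)).of_nonneg_of_le (fun _ => (h.pos _).le) (h.add_le k)

theorem summable (h : AdaptedWeights g δ γ p L) : Summable p := h.summable_add 0

theorem tsum_add_le (h : AdaptedWeights g δ γ p L) (k : ℕ) : ∑' m, p (m + k) ≤ 2 * p k := by
  refine ((h.summable_add k).tsum_le_tsum (h.add_le k)
    (summable_geometric_two.mul_left (p k))).trans_eq ?_
  rw [tsum_mul_left, tsum_geometric_two, mul_comm]

theorem tsum_le (h : AdaptedWeights g δ γ p L) : ∑' m, p m ≤ δ :=
  (h.tsum_add_le 0).trans h.two_mul_zero_le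

theorem two_mul_le (h : AdaptedWeights g δ γ p L) (k : ℕ) : 2 * p k ≤ δ := by
  have h1 := h.add_le 0 k
  have h2 : p 0 * (1 / 2) ^ k ≤ p 0 :=
    mul_le_of_le_one_right (h.pos 0).le (pow_le_one₀ (by norm_num) (by norm_num))
  have h3 := h.two_mul_zero_le
  rw [add_zero] at h1
  linarith

theorem neZero (h : AdaptedWeights g δ γ p L) (k : ℕ) : NeZero (L k) :=
  ⟨(Nat.zero_le _).trans_lt (h.lt_period k) |>.ne'⟩

theorem le_period (h : AdaptedWeights g δ γ p L) (k : ℕ) : k ≤ L k :=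
  (Nat.le_mul_of_pos_right k (by omega)).trans (h.lt_period k).le

variable [∀ k, NeZero (L k)]

theorem summable_mul_wordFreq (h : AdaptedWeights g δ γ p L) {n : ℕ} (w : Fin n → Fin 2) :
    Summable fun k => p k * wordFreq (L k) w :=
  h.summable.of_nonneg_of_le (fun k => mul_nonneg (h.pos k).le (wordFreq_nonneg _ _))
    fun k => mul_le_of_le_one_right (h.pos k).le (wordFreq_le_one _ _)

theorem tsum_mul_wordFreq_nonneg (h : AdaptedWeights g δ γ p L) {n : ℕ} (w : Fin n → Fin 2) :
    0 ≤ ∑' k, p k * wordFreq (L k) w :=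
  tsum_nonneg fun k => mul_nonneg (h.pos k).le (wordFreq_nonneg _ _)

theorem tsum_mul_wordFreq_le (h : AdaptedWeights g δ γ p L) {n : ℕ} (w : Fin n → Fin 2) :
    ∑' k, p k * wordFreq (L k) w ≤ δ :=
  ((h.summable_mul_wordFreq w).tsum_le_tsum
    (fun k => mul_le_of_le_one_right (h.pos k).le (wordFreq_le_one _ _)) h.summable).trans
    h.tsum_le

theorem tsum_add_mul_wordFreq_le (h : AdaptedWeights g δ γ p L) {n : ℕ} (w : Fin n → Fin 2)
    (k : ℕ) : ∑' m, p (m + k) * wordFreq (L (m + k)) w ≤ 2 * p k :=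
  (((summable_nat_add_iff k).mpr (h.summable_mul_wordFreq w)).tsum_le_tsum
    (fun _ => mul_le_of_le_one_right (h.pos _).le (wordFreq_le_one _ _)) (h.summable_add k)).trans
    (h.tsum_add_le k)

/-- Up to the period this is Jensen's inequality over `2 ^ n` words; afterwards the sum stays at `γ
* L k`. -/
theorem sum_component_le (h : AdaptedWeights g δ γ p L) (hg : g ∈ G0) (hδ : δ ≤ 1 / 2)
    (hγ : 0 < γ) (k : ℕ) {n : ℕ} (hn : 1 ≤ n) :
    ∑ w : Fin n → Fin 2, g (p k * wordFreq (L k) w) ≤ γ * n := by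
  rcases le_total n (L k) with hnL | hnL
  · refine (hg.1.sum_le_card_mul _ fun w =>
      ⟨mul_nonneg (h.pos k).le (wordFreq_nonneg _ _), ?_⟩).trans ?_
    · have := mul_le_of_le_one_right (h.pos k).le (wordFreq_le_one (L k) w)
      linarith [h.two_mul_le k, h.pos k]
    · rw [← Finset.mul_sum, sum_wordFreq, mul_one]
      simpa using h.le_mul k n hn hnL
  · rw [sum_comp_wordFreq (L k) hg.2.1 _ hnL, h.eq_mul]
    gcongr

/-- The three terms of the bound come from the frozen components `j < k`, component `k`, and the
tail. -/
theorem sum_comp_tsum_le (h : AdaptedWeights g δ γ p L) (hg : g ∈ G0) (hδ : δ ≤ 1 / 2)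
    (hmono : MonotoneOn g (Icc 0 δ)) (hγ : 0 < γ) {k n : ℕ} (hn : 1 ≤ n)
    (hkn : k * (1 + ∑ j ∈ Finset.range k, L j) ≤ n)
    (hnk : n < (k + 1) * (1 + ∑ j ∈ Finset.range (k + 1), L j)) :
    ∑ w : Fin n → Fin 2, g (∑' j, p j * wordFreq (L j) w) ≤
      γ * ((∑ j ∈ Finset.range k, L j : ℕ) : ℝ) + γ * n + γ / 2 := by
  have hpt : ∀ w : Fin n → Fin 2, g (∑' j, p j * wordFreq (L j) w) ≤
      ∑ j ∈ Finset.range (k + 1), g (p j * wordFreq (L j) w) + g (2 * p (k + 1)) := by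
    intro w
    have hnn : ∀ j, 0 ≤ p j * wordFreq (L j) w :=
      fun j => mul_nonneg (h.pos j).le (wordFreq_nonneg _ _)
    set t := ∑' m, p (m + (k + 1)) * wordFreq (L (m + (k + 1))) w with ht
    have hsplit : ∑ j ∈ Finset.range (k + 1), p j * wordFreq (L j) w + t =
        ∑' j, p j * wordFreq (L j) w := (h.summable_mul_wordFreq w).sum_add_tsum_nat_add (k + 1)
    have ht0 : 0 ≤ t := tsum_nonneg fun _ => hnn _
    have hle := h.tsum_mul_wordFreq_le w
    have hgt : g t ≤ g (2 * p (k + 1)) := by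
      have h1 := h.tsum_add_mul_wordFreq_le w (k + 1)
      have h2 := h.two_mul_le (k + 1)
      exact hmono ⟨ht0, h1.trans h2⟩ ⟨ht0.trans h1, h2⟩ h1
    -- Subadditivity for finitely many summands: the whole tail `t` is lumped into the extra index
    -- `k + 1`.
    have hsub := hg.1.map_sum_le_of_map_zero hg.2.1 (Finset.range (k + 2))
      (fun j => if j < k + 1 then p j * wordFreq (L j) w else t)
      (fun j _ => by split_ifs; exacts [hnn j, ht0])
    have hreorg : ∀ f : ℝ → ℝ, ∑ j ∈ Finset.range (k + 2),
        f (if j < k + 1 then p j * wordFreq (L j) w else t) =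
        ∑ j ∈ Finset.range (k + 1), f (p j * wordFreq (L j) w) + f t := by
      intro f
      rw [Finset.sum_range_succ]
      congr 1
      · exact Finset.sum_congr rfl fun j hj => by rw [if_pos (Finset.mem_range.mp hj)]
      · simp
    rw [hreorg g, show ∑ j ∈ Finset.range (k + 2),
      (if j < k + 1 then p j * wordFreq (L j) w else t) = _ from hreorg id] at hsub
    simp only [id, hsplit] at hsub
    linarith [hsub (by linarith)]
  have hearly : ∀ j ∈ Finset.range k,
      ∑ w : Fin n → Fin 2, g (p j * wordFreq (L j) w) = γ * L j := by
    intro j hj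
    rw [sum_comp_wordFreq (L j) hg.2.1, h.eq_mul]
    have h1 := Finset.single_le_sum (f := L) (fun i _ => Nat.zero_le _) hj
    have h2 := Finset.mem_range.mp hj
    -- Here `k ≥ 1` since `j < k`; hence `L j ≤ n` and component `j` is frozen.
    have h3 : 1 + ∑ j ∈ Finset.range k, L j ≤ k * (1 + ∑ j ∈ Finset.range k, L j) :=
      Nat.le_mul_of_pos_left _ (by omega)
    omega
  have hnonneg : 0 ≤ g (2 * p (k + 1)) := by
    have h1 := h.two_mul_le (k + 1)
    have h2 := h.pos (k + 1)
    rw [← hg.2.1]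
    exact hmono ⟨le_rfl, by linarith⟩ ⟨by linarith, h1⟩ (by linarith)
  have htail : 2 ^ n * g (2 * p (k + 1)) ≤ γ / 2 :=
    (mul_le_mul_of_nonneg_right (pow_le_pow_right₀ one_le_two hnk.le) hnonneg).trans
      (h.tail_le (k + 1))
  refine (Finset.sum_le_sum fun w _ => hpt w).trans ?_
  rw [Finset.sum_add_distrib, Finset.sum_comm, Finset.sum_range_succ, Finset.sum_congr rfl hearly,
    ← Finset.mul_sum, Nat.cast_sum]
  have := h.sum_component_le hg hδ hγ k hn
  simp only [Finset.sum_const, Finset.card_univ, Fintype.card_fun, Fintype.card_fin, nsmul_eq_mul]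
  push_cast
  linarith

/-- Total cell masses stay in `[0, δ]`, where `g` is monotone, so discarding all components but `k`
can only lower the sum. -/
theorem le_sum_comp_tsum (h : AdaptedWeights g δ γ p L) (hg : g ∈ G0)
    (hmono : MonotoneOn g (Icc 0 δ)) (k : ℕ) :
    γ * L k ≤ ∑ w : Fin (L k) → Fin 2, g (∑' j, p j * wordFreq (L j) w) := by
  rw [← h.eq_mul, ← sum_comp_wordFreq (L k) hg.2.1 (p k) le_rfl]
  refine Finset.sum_le_sum fun w _ => ?_
  have hnn : ∀ j, 0 ≤ p j * wordFreq (L j) w :=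
    fun j => mul_nonneg (h.pos j).le (wordFreq_nonneg _ _)
  have hle : p k * wordFreq (L k) w ≤ ∑' j, p j * wordFreq (L j) w :=
    (h.summable_mul_wordFreq w).le_tsum k fun j _ => hnn j
  have hδ' := h.tsum_mul_wordFreq_le w
  exact hmono ⟨hnn k, hle.trans hδ'⟩ ⟨(hnn k).trans hle, hδ'⟩ hle

theorem eventually_sum_comp_tsum_le (h : AdaptedWeights g δ γ p L) (hg : g ∈ G0)
    (hδ : δ ≤ 1 / 2) (hmono : MonotoneOn g (Icc 0 δ)) (hγ : 0 < γ) {ε : ℝ} (hε : 0 < ε) :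
    ∀ᶠ n : ℕ in atTop,
      ∑ w : Fin n → Fin 2, g (∑' j, p j * wordFreq (L j) w) ≤ (γ + ε) * n + γ / 2 := by
  -- From block `K` on, the frozen components contribute at most `γ * n / K ≤ ε * n`.
  obtain ⟨K, hK⟩ := exists_nat_gt (γ / ε)
  have hKpos : (0 : ℝ) < K := (div_pos hγ hε).trans hK
  have hK1 : 1 ≤ K := by exact_mod_cast hKpos
  filter_upwards [eventually_ge_atTop ((K * (1 + ∑ j ∈ Finset.range K, L j)) + 1)] with n hn
  obtain ⟨k, hkn, hnk⟩ : ∃ k, k * (1 + ∑ j ∈ Finset.range k, L j) ≤ n ∧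
      n < (k + 1) * (1 + ∑ j ∈ Finset.range (k + 1), L j) := by
    have hex : ∃ k, n < k * (1 + ∑ j ∈ Finset.range k, L j) :=
      ⟨n + 1, (Nat.lt_succ_self n).trans_le ((strictMono_mul_one_add_sum L).le_apply (x := n + 1))⟩
    classical
    -- The first threshold exceeding `n` is not the one of index `0`, which equals `0`.
    obtain ⟨k, hk⟩ : ∃ k, Nat.find hex = k + 1 := by
      refine Nat.exists_eq_succ_of_ne_zero fun h0 => ?_
      have := Nat.find_spec hex
      rw [h0] at this
      simp at this
    refine ⟨k, not_lt.mp (Nat.find_min hex (by omega)), ?_⟩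
    have := Nat.find_spec hex
    rwa [hk] at this
  have hKk : K ≤ k := by
    by_contra! hlt
    have := (strictMono_mul_one_add_sum L).monotone (Nat.succ_le_of_lt hlt)
    simp only [Nat.succ_eq_add_one] at this
    omega
  refine (h.sum_comp_tsum_le hg hδ hmono hγ (by omega) hkn hnk).trans ?_
  have hsum : γ * ((∑ j ∈ Finset.range k, L j : ℕ) : ℝ) ≤ ε * n := by
    have h1 : K * ∑ j ∈ Finset.range k, L j ≤ n :=
      (Nat.mul_le_mul hKk (Nat.le_add_left _ 1)).trans hkn
    have h2 : (K : ℝ) * ((∑ j ∈ Finset.range k, L j : ℕ) : ℝ) ≤ n := by exact_mod_cast h1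
    have h3 : γ ≤ K * ε := ((div_lt_iff₀ hε).mp hK).le
    calc γ * ((∑ j ∈ Finset.range k, L j : ℕ) : ℝ)
        ≤ K * ε * ((∑ j ∈ Finset.range k, L j : ℕ) : ℝ) := by gcongr
      _ = ε * (K * ((∑ j ∈ Finset.range k, L j : ℕ) : ℝ)) := by ring
      _ ≤ ε * n := by gcongr
  linarith

/-- The mass on the zero sequence affects only the cell of the zero word. Its mass may leave the
interval where `g` is monotone, but one cell changes the sum by a bounded amount, negligible after
division by `n`. -/
theorem abs_staticEntropy_sub_le (h : AdaptedWeights g δ γ p L) (hδ : δ ≤ 1 / 2) {M : ℝ}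
    (hM : ∀ x ∈ Icc (0 : ℝ) 1, |g x| ≤ M) (n : ℕ) :
    |(zeroCoordinatePartition.iteratedJoin binaryShift n).staticEntropy (periodicMixture p L) g -
      ∑ w : Fin n → Fin 2, g (∑' j, p j * wordFreq (L j) w)| ≤ 2 * M := by
  have hP : ∑' k, p k ≤ 1 := h.tsum_le.trans (by linarith)
  have := isProbabilityMeasure_periodicMixture L (fun k => (h.pos k).le) h.summable hP
  have hreal := fun w : Fin n → Fin 2 =>
    periodicMixture_real_cell L (fun k => (h.pos k).le) h.summable hP w
  rw [MeasurablePartition.staticEntropy, ← Finset.sum_sub_distrib,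
    Finset.sum_eq_single_of_mem (0 : Fin n → Fin 2) (Finset.mem_univ _)]
  · refine (abs_sub _ _).trans ?_
    have h1 := hM _ ⟨measureReal_nonneg (μ := periodicMixture p L)
      (s := (zeroCoordinatePartition.iteratedJoin binaryShift n).cell 0), measureReal_le_one⟩
    have h2 := hM _ ⟨h.tsum_mul_wordFreq_nonneg (0 : Fin n → Fin 2),
      (h.tsum_mul_wordFreq_le 0).trans (by linarith)⟩
    linarith
  · intro w _ hw
    rw [hreal, if_neg hw, zero_add, sub_self]

theorem gEntropy_eq (h : AdaptedWeights g δ γ p L) (hg : g ∈ G0)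
    (hδ : δ ≤ 1 / 2) (hmono : MonotoneOn g (Icc 0 δ)) (hγ : 0 < γ)
    (hμ : IsProbabilityMeasure (periodicMixture p L)) :
    (binaryShiftSystem (periodicMixture p L) hμ
      (measurePreserving_periodicMixture L p)).gEntropy g = γ := by
  obtain ⟨M, hM0, hM⟩ := hg.1.exists_abs_le_Icc
  have hdiff := h.abs_staticEntropy_sub_le hδ hM
  refine limsup_coe_ereal_eq (u := fun n : ℕ => 1 / (n : ℝ) *
    (zeroCoordinatePartition.iteratedJoin binaryShift n).staticEntropy (periodicMixture p L) g)
    (fun ε hε => ?_) fun ε hε => ?_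
  · filter_upwards [h.eventually_sum_comp_tsum_le hg hδ hmono hγ (half_pos hε),
      (tendsto_const_div_atTop_nhds_zero_nat (γ / 2 + 2 * M)).eventually_le_const (half_pos hε),
      eventually_gt_atTop 0] with n h1 h2 hn
    have hn' : (0 : ℝ) < n := by exact_mod_cast hn
    rw [div_le_iff₀ hn'] at h2
    rw [one_div, inv_mul_le_iff₀ hn']
    have := (abs_le.mp (hdiff n)).2
    linarith
  -- The rate `γ` is approached along the periods `n = L k`, which is enough for a limsup.
  · have hlim : Tendsto L atTop atTop := tendsto_atTop_mono h.le_period tendsto_id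
    refine hlim.frequently (Eventually.frequently ?_)
    filter_upwards [hlim.eventually ((tendsto_const_div_atTop_nhds_zero_nat
      (2 * M)).eventually_le_const hε)] with k hk
    have hLk : (0 : ℝ) < L k := by exact_mod_cast Nat.pos_of_ne_zero (NeZero.ne (L k))
    rw [div_le_iff₀ hLk] at hk
    rw [one_div, le_inv_mul_iff₀ hLk]
    have h1 := (abs_le.mp (hdiff (L k))).1
    have h2 := h.le_sum_comp_tsum hg hmono k
    linarith

end AdaptedWeights

/-! ### The case of zero entropy and the conclusion -/

/-- This settles `γ = 0`, which the choice of weights excludes. One cell has full mass, so the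
static entropy is the constant `g 1`. -/
theorem gEntropy_dirac_zero {g : ℝ → ℝ} (h0 : g 0 = 0)
    (hμ : IsProbabilityMeasure (Measure.dirac (0 : ℤ → Fin 2)))
    (hinv : MeasurePreserving binaryShift (Measure.dirac (0 : ℤ → Fin 2)) (Measure.dirac 0)) :
    (binaryShiftSystem (Measure.dirac 0) hμ hinv).gEntropy g = ((0 : ℝ) : EReal) := by
  have hS : ∀ n : ℕ, (zeroCoordinatePartition.iteratedJoin binaryShift n).staticEntropy
      (Measure.dirac 0) g = g 1 := by
    intro n
    have hmem : ∀ w : Fin n → Fin 2,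
        (0 : ℤ → Fin 2) ∈ (zeroCoordinatePartition.iteratedJoin binaryShift n).cell w ↔ w = 0 := by
      intro w
      rw [mem_iteratedJoin_cell, funext_iff]
      simp [eq_comm]
    have hreal : ∀ w : Fin n → Fin 2, (Measure.dirac (0 : ℤ → Fin 2)).real
        ((zeroCoordinatePartition.iteratedJoin binaryShift n).cell w) = if w = 0 then 1 else 0 := by
      classical
      intro w
      rw [Measure.real, Measure.dirac_apply' _ (MeasurablePartition.measurableSet_cell _ w),
        indicator_apply]
      simp only [hmem]
      split_ifs <;> simp
    simp [MeasurablePartition.staticEntropy, hreal, apply_ite g, h0]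
  have hlim : Tendsto (fun n : ℕ => 1 / (n : ℝ) *
      (zeroCoordinatePartition.iteratedJoin binaryShift n).staticEntropy (Measure.dirac 0) g)
      atTop (𝓝 0) := by
    simp only [hS, one_div_mul_eq_div]
    exact tendsto_const_div_atTop_nhds_zero_nat _
  exact Tendsto.limsup_eq ((continuous_coe_real_ereal.tendsto 0).comp hlim)

theorem mainTheorem6 (g : ℝ → ℝ) (hg : g ∈ G0Infty)
    (hdiff : DifferentiableOn ℝ g (Ioo 0 1))
    (hlimsup : limsup (fun x : ℝ => ((x * deriv g x / g x : ℝ) : EReal)) (𝓝[>] 0) < 1)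
    (γ : ℝ) (hγ : 0 ≤ γ) :
    ∃ (μ : Measure (ℤ → Fin 2)) (hμ : IsProbabilityMeasure μ)
      (hinv : MeasurePreserving binaryShift μ μ),
      (binaryShiftSystem μ hμ hinv).gEntropy g = (γ : EReal) ∧
      (binaryShiftSystem μ hμ hinv).shannonEntropy = 0 := by
  suffices h : ∃ (μ : Measure (ℤ → Fin 2)) (hμ : IsProbabilityMeasure μ)
      (hinv : MeasurePreserving binaryShift μ μ),
      (binaryShiftSystem μ hμ hinv).gEntropy g = (γ : EReal) by
    obtain ⟨μ, hμ, hinv, h⟩ := h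
    exact ⟨μ, hμ, hinv, h, PartitionedSystem.shannonEntropy_eq_zero _ hg hγ h⟩
  rcases hγ.eq_or_lt with rfl | hγ
  · have hinv : MeasurePreserving binaryShift (Measure.dirac (0 : ℤ → Fin 2))
        (Measure.dirac 0) :=
      ⟨binaryShift.measurable, Measure.map_dirac' binaryShift.measurable _⟩
    exact ⟨Measure.dirac 0, inferInstance, hinv, gEntropy_dirac_zero hg.1.2.1 _ hinv⟩
  · obtain ⟨δ, hδ0, hδ, hmono⟩ := G0Infty.exists_monotoneOn hg
    obtain ⟨p, L, h⟩ := exists_adaptedWeights hg hδ0 hδ hmono hγ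
    have := h.neZero
    have hμ := isProbabilityMeasure_periodicMixture L (fun k => (h.pos k).le) h.summable
      (h.tsum_le.trans (by linarith))
    exact ⟨_, hμ, measurePreserving_periodicMixture L p, h.gEntropy_eq hg.1 hδ hmono hγ hμ⟩
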